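/- Let $F$ be an algebraically closed field of characteristic $0$ and let $n\ge 5$. Let $M_n=M_n(F)$, let $\mathfrak{gl}(n^2)=\mathrm{End}_F(M_n)$ be the space of all $F$-linear operators on $M_n$, and let $\mathfrak g=\{x\mapsto ax-xa \mid a\in M_n\}\subseteq \mathfrak{gl}(n^2)$ be the set of all inner derivations of $M_n$. Write $M_n^0=\{a\in M_n\mid \operatorname{tr}(a)=0\}$, so that $M_n=M_n^0\oplus F1$. Let $\mathfrak{gl}(n^2-1)$ be the set of all $f\in\mathfrak{gl}(n^2)$ with $f(M_n^0)\subseteq M_n^0$, $f(F1)\subseteq F1$ and $f(1)=0$. Let $\mathfrak p=\{x\mapsto \operatorname{tr}(x)a\mid a\in M_n^0\}$ and $\mathfrak q=\{x\mapsto \operatorname{tr}(xa)1\mid a\in M_n^0\}$. Let $T$ be the group of all operators $t\in\mathfrak{gl}(n^2)$ for which there are nonzero $\alpha,\beta\in F$ such that $t$ acts as multiplication by $\alpha$ on $M_n^0$ and as multiplication by $\beta$ on $F1$. A linear subspace $A$ of $\mathfrak{gl}(n^2)$ is a proper associative (not necessarily unital) subalgebra of $\mathfrak{gl}(n^2)$,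 under composition, that contains $\mathfrak g$ if and only if $A$ is one of $$\mathfrak{gl}(n^2-1),\quad \mathfrak{gl}(n^2-1)+\mathfrak p,\quad \mathfrak{gl}(n^2-1)+\mathfrak q,$$ $$\mathfrak{gl}(n^2-1)+Ft,\quad \mathfrak{gl}(n^2-1)+\mathfrak p+Ft,\quad \mathfrak{gl}(n^2-1)+\mathfrak q+Ft$$ for some $t\in T$. Moreover, there are exactly six such subalgebras $A$. -/

import Mathlib

namespace InnerDerivations

/-- The space `M_n` of `n × n` matrices over `F`. -/
abbrev Mat (F : Type*) (n : ℕ) : Type _ := Matrix (Fin n) (Fin n) F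

/-- The algebra `gl(n²)` of all linear operators on the space `M_n`
(with composition as associative product). -/
abbrev Gl (F : Type*) [Field F] (n : ℕ) : Type _ := Module.End F (Mat F n)

/-- The space `M_n⁰` of matrices of trace zero. -/
def traceZero (F : Type*) [Field F] (n : ℕ) : Submodule F (Mat F n) :=
  LinearMap.ker (Matrix.traceLinearMap (Fin n) F F)

/-- The line `F1` of scalar matrices. -/
def scalars (F : Type*) [Field F] (n : ℕ) : Submodule F (Mat F n) :=
  Submodule.span F {1}

/-- The space `g` of all inner derivations `x ↦ ax - xa` of `M_n`. -/
def innerDer (F : Type*) [Field F] (n : ℕ) : Submodule F (Gl F n) :=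
  LinearMap.range (LinearMap.mul F (Mat F n) - (LinearMap.mul F (Mat F n)).flip)

/-- `gl(n² - 1)`: the operators that preserve the decomposition `M_n = M_n⁰ + F1`
and send `1` to `0`. -/
def glSub (F : Type*) [Field F] (n : ℕ) : Submodule F (Gl F n) where
  carrier := {f | (∀ x ∈ traceZero F n, f x ∈ traceZero F n) ∧
    (∀ x ∈ scalars F n, f x ∈ scalars F n) ∧ f 1 = 0}
  add_mem' := fun {f g} hf hg =>
    ⟨fun x hx => add_mem (hf.1 x hx) (hg.1 x hx),
      fun x hx => add_mem (hf.2.1 x hx) (hg.2.1 x hx),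
      by rw [LinearMap.add_apply, hf.2.2, hg.2.2, add_zero]⟩
  zero_mem' := ⟨fun _ _ => zero_mem _, fun _ _ => zero_mem _, rfl⟩
  smul_mem' := fun c f hf =>
    ⟨fun x hx => Submodule.smul_mem _ c (hf.1 x hx),
      fun x hx => Submodule.smul_mem _ c (hf.2.1 x hx),
      by rw [LinearMap.smul_apply, hf.2.2, smul_zero]⟩

/-- The linear map taking `a` to the operator `x ↦ tr(x) a`. -/
def pMap (F : Type*) [Field F] (n : ℕ) : Mat F n →ₗ[F] Gl F n :=
  LinearMap.smulRightₗ (Matrix.traceLinearMap (Fin n) F F)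

/-- The linear map taking `a` to the operator `x ↦ tr(x a) 1`. -/
def qMap (F : Type*) [Field F] (n : ℕ) : Mat F n →ₗ[F] Gl F n :=
  LinearMap.mk₂ F (fun a x => (x * a).trace • (1 : Mat F n))
    (fun a b x => by rw [mul_add, Matrix.trace_add, add_smul])
    (fun c a x => by rw [Matrix.mul_smul, Matrix.trace_smul, smul_assoc])
    (fun a x y => by rw [add_mul, Matrix.trace_add, add_smul])
    (fun c a x => by rw [Matrix.smul_mul, Matrix.trace_smul, smul_assoc])

/-- The space `p` of all operators `x ↦ tr(x) a` with `a ∈ M_n⁰`. -/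
def pSpace (F : Type*) [Field F] (n : ℕ) : Submodule F (Gl F n) :=
  (traceZero F n).map (pMap F n)

/-- The space `q` of all operators `x ↦ tr(x a) 1` with `a ∈ M_n⁰`. -/
def qSpace (F : Type*) [Field F] (n : ℕ) : Submodule F (Gl F n) :=
  (traceZero F n).map (qMap F n)

/-- The group `T` of all operators that, for some nonzero scalars `α` and `β`, act as
multiplication by `α` on `M_n⁰` and by `β` on `F1`. -/
def torus (F : Type*) [Field F] (n : ℕ) : Set (Gl F n) :=
  {t | ∃ α β : F, α ≠ 0 ∧ β ≠ 0 ∧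
    (∀ x ∈ traceZero F n, t x = α • x) ∧ (∀ x ∈ scalars F n, t x = β • x)}

/-- The line `Ft`. -/
def line {F : Type*} [Field F] {n : ℕ} (t : Gl F n) : Submodule F (Gl F n) :=
  Submodule.span F {t}

/-- The linear subspace `A` of `gl(n²)` is a proper associative (not necessarily unital)
subalgebra that contains all inner derivations. -/
def IsProperSubalgebraOverInnerDer {F : Type*} [Field F] {n : ℕ}
    (A : Submodule F (Gl F n)) : Prop :=
  (∃ B : NonUnitalSubalgebra F (Gl F n), B.toSubmodule = A) ∧ A ≠ ⊤ ∧ innerDer F n ≤ A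

end InnerDerivations

namespace InnerDerivations

variable {F : Type*} [Field F] {n : ℕ}

/-! Let `P` and `S` be the projections for `M_n = M_n⁰ ⊕ F1`, and let `A` be a subalgebra containing
all inner derivations. For `e = e_ij` with `i ≠ j` we have `e² = 0`, so `(ad e)²` is `x ↦ -2 e x e =
-2 tr(x e) e`, an operator of rank one (`rankOne_single_mem`). Composing with `ad c` on either side
moves its vector and its functional through Lie ideals, and these exhaust `M_n⁰`. The resulting
operators `x ↦ tr(x b) a` with `a, b ∈ M_n⁰` span `gl(n² - 1)`, so `A` contains it
(`glSub_le_of_innerDer_le`).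

In particular `P ∈ A`, hence `A` contains all four blocks of each of its elements. The blocks `p`
and `q` are simple as left and right modules over `gl(n² - 1)`, and `FS` is a line. So each of the
three either lies in `A` or is absent from every element of `A`. If both `p` and `q` lie in `A`,
then `S`, a multiple of a product from `q · p`, does too, and `A` is everything. The six remaining
patterns are the six algebras (`eq_of_glSub_le`). Since `t = αP + βS` with `β ≠ 0`, adding `Ft` to
`gl(n² - 1)` amounts to adding `FS`. -/

theorem mem_traceZero {x : Mat F n} : x ∈ traceZero F n ↔ x.trace = 0 := by
  simp [traceZero]

theorem mem_scalars {x : Mat F n} : x ∈ scalars F n ↔ ∃ c : F, c • (1 : Mat F n) = x :=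
  Submodule.mem_span_singleton

theorem trace_one_eq : (1 : Mat F n).trace = n := by
  simp [Matrix.trace_one]

/-- The projection onto `F1` along `M_n⁰`. -/
noncomputable def scalarProj (F : Type*) [Field F] (n : ℕ) : Gl F n :=
  (n : F)⁻¹ • pMap F n 1

theorem scalarProj_apply (x : Mat F n) :
    scalarProj F n x = ((n : F)⁻¹ * x.trace) • (1 : Mat F n) := by
  simp [scalarProj, pMap, smul_smul]

theorem pMap_apply (a x : Mat F n) : pMap F n a x = x.trace • a := by
  simp [pMap]

theorem qMap_apply (a x : Mat F n) : qMap F n a x = (x * a).trace • (1 : Mat F n) := rfl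

theorem mem_glSub {f : Gl F n} :
    f ∈ glSub F n ↔ (∀ x, x.trace = 0 → (f x).trace = 0) ∧ f 1 = 0 := by
  constructor
  · rintro ⟨h, -, h1⟩
    exact ⟨fun x hx => mem_traceZero.1 (h x (mem_traceZero.2 hx)), h1⟩
  · rintro ⟨h, h1⟩
    refine ⟨fun x hx => mem_traceZero.2 (h x (mem_traceZero.1 hx)), fun x hx => ?_, h1⟩
    obtain ⟨c, rfl⟩ := mem_scalars.1 hx
    rw [map_smul, h1, smul_zero]
    exact zero_mem _

/-- The line spanned by the projection onto `F1`. -/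
noncomputable abbrev scalarBlock (F : Type*) [Field F] (n : ℕ) : Submodule F (Gl F n) :=
  line (scalarProj F n)

/-- The operators that map `F1` to itself. -/
def scalarStab (F : Type*) [Field F] (n : ℕ) : Submodule F (Gl F n) where
  carrier := {f | ∃ c : F, f 1 = c • (1 : Mat F n)}
  add_mem' := by
    rintro f g ⟨c, hc⟩ ⟨d, hd⟩
    exact ⟨c + d, by rw [LinearMap.add_apply, hc, hd, add_smul]⟩
  zero_mem' := ⟨0, by simp⟩
  smul_mem' := by
    rintro r f ⟨c, hc⟩
    exact ⟨r * c, by rw [LinearMap.smul_apply, hc, smul_smul]⟩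

/-- The operators that map `M_n⁰` to itself. -/
def traceZeroStab (F : Type*) [Field F] (n : ℕ) : Submodule F (Gl F n) where
  carrier := {f | ∀ x : Mat F n, x.trace = 0 → (f x).trace = 0}
  add_mem' := fun {f g} hf hg x hx => by
    rw [LinearMap.add_apply, Matrix.trace_add, hf x hx, hg x hx, add_zero]
  zero_mem' := fun x _ => by simp
  smul_mem' := fun c f hf x hx => by
    rw [LinearMap.smul_apply, Matrix.trace_smul, hf x hx, smul_zero]

/-- The operators that map `1` into `M_n⁰`. -/
def oneToTraceZero (F : Type*) [Field F] (n : ℕ) : Submodule F (Gl F n) where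
  carrier := {f | (f 1).trace = 0}
  add_mem' := fun {f g} hf hg => by
    simp only [Set.mem_ofPred_eq] at *
    rw [LinearMap.add_apply, Matrix.trace_add, hf, hg, add_zero]
  zero_mem' := by simp
  smul_mem' := fun c f hf => by
    simp only [Set.mem_ofPred_eq] at *
    rw [LinearMap.smul_apply, Matrix.trace_smul, hf, smul_zero]

theorem mem_scalarStab {f : Gl F n} :
    f ∈ scalarStab F n ↔ ∃ c : F, f 1 = c • (1 : Mat F n) := Iff.rfl

theorem mem_traceZeroStab {f : Gl F n} :
    f ∈ traceZeroStab F n ↔ ∀ x : Mat F n, x.trace = 0 → (f x).trace = 0 := Iff.rfl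

theorem mem_oneToTraceZero {f : Gl F n} :
    f ∈ oneToTraceZero F n ↔ (f 1).trace = 0 := Iff.rfl

theorem mem_pSpace (hn : (n : F) ≠ 0) {f : Gl F n} :
    f ∈ pSpace F n ↔ (∀ x, x.trace = 0 → f x = 0) ∧ (f 1).trace = 0 := by
  constructor
  · rintro ⟨a, ha, rfl⟩
    have ha := mem_traceZero.1 ha
    exact ⟨fun x hx => by simp [pMap_apply, hx], by simp [pMap_apply, ha]⟩
  · rintro ⟨h, h1⟩
    refine ⟨(n : F)⁻¹ • f 1, mem_traceZero.2 (by simp [h1]), ?_⟩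
    ext1 x
    have hx := h (x - ((n : F)⁻¹ * x.trace) • 1) (by
      simp [Matrix.trace_one]; field_simp; simp)
    rw [map_sub, map_smul, sub_eq_zero] at hx
    rw [pMap_apply, hx, smul_smul, mul_comm]

/-- The trace form is nondegenerate, and `e_ji` is dual to `e_ij`. -/
theorem exists_trace_mul_eq (φ : Mat F n →ₗ[F] F) : ∃ a : Mat F n, ∀ x, (x * a).trace = φ x := by
  refine ⟨Matrix.of fun i j => φ (Matrix.single j i 1), fun x => ?_⟩
  conv_rhs => rw [Matrix.matrix_eq_sum_single x]
  simp only [map_sum, Matrix.trace, Matrix.diag, Matrix.mul_apply, Matrix.of_apply]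
  refine Finset.sum_congr rfl fun i _ => Finset.sum_congr rfl fun j _ => ?_
  have : Matrix.single i j (x i j) = x i j • Matrix.single i j (1 : F) := by
    simp [Matrix.smul_single]
  rw [this, map_smul, smul_eq_mul]

theorem mem_qSpace (hn : (n : F) ≠ 0) {f : Gl F n} :
    f ∈ qSpace F n ↔ (∀ x, ∃ c : F, f x = c • (1 : Mat F n)) ∧ f 1 = 0 := by
  constructor
  · rintro ⟨a, ha, rfl⟩
    have ha := mem_traceZero.1 ha
    exact ⟨fun x => ⟨_, rfl⟩, by simp [qMap_apply, ha]⟩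
  · rintro ⟨h, h1⟩
    obtain ⟨a, ha⟩ := exists_trace_mul_eq
      ((n : F)⁻¹ • (Matrix.traceLinearMap (Fin n) F F ∘ₗ f))
    refine ⟨a, mem_traceZero.2 ?_, ?_⟩
    · rw [← one_mul a, ha]
      simp [h1]
    · ext1 x
      obtain ⟨c, hc⟩ := h x
      rw [qMap_apply, ha]
      simp [hc, Matrix.trace_one]
      field_simp

theorem mem_scalarBlock (hn : (n : F) ≠ 0) {f : Gl F n} :
    f ∈ scalarBlock F n ↔
      (∀ x, x.trace = 0 → f x = 0) ∧ ∃ c : F, f 1 = c • (1 : Mat F n) := by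
  rw [scalarBlock, line, Submodule.mem_span_singleton]
  constructor
  · rintro ⟨c, rfl⟩
    exact ⟨fun x hx => by simp [scalarProj_apply, hx],
      c, by simp [scalarProj_apply, Matrix.trace_one, hn]⟩
  · rintro ⟨h, c, h1⟩
    refine ⟨c, ?_⟩
    ext1 x
    have hx := h (x - ((n : F)⁻¹ * x.trace) • 1) (by
      simp [Matrix.trace_one]; field_simp; simp)
    rw [map_sub, map_smul, sub_eq_zero] at hx
    rw [hx, h1, LinearMap.smul_apply, scalarProj_apply, smul_comm]

/-! ### Block decomposition relative to `M_n⁰ ⊕ F1` -/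

/-- The projection onto `M_n⁰` along `F1`. -/
noncomputable def traceZeroProj (F : Type*) [Field F] (n : ℕ) : Gl F n :=
  1 - scalarProj F n

theorem traceZeroProj_apply (x : Mat F n) :
    traceZeroProj F n x = x - ((n : F)⁻¹ * x.trace) • (1 : Mat F n) := by
  rw [traceZeroProj, LinearMap.sub_apply, scalarProj_apply]
  rfl

theorem traceZeroProj_of_trace_eq_zero {x : Mat F n} (hx : x.trace = 0) :
    traceZeroProj F n x = x := by
  simp [traceZeroProj_apply, hx]

theorem trace_traceZeroProj (hn : (n : F) ≠ 0) (x : Mat F n) :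
    (traceZeroProj F n x).trace = 0 := by
  simp [traceZeroProj_apply, Matrix.trace_one]
  field_simp
  simp

theorem traceZeroProj_one (hn : (n : F) ≠ 0) : traceZeroProj F n 1 = 0 := by
  simp [traceZeroProj_apply, Matrix.trace_one, hn]

theorem traceZeroProj_mem_glSub (hn : (n : F) ≠ 0) : traceZeroProj F n ∈ glSub F n :=
  mem_glSub.2 ⟨fun x _ => trace_traceZeroProj hn x, traceZeroProj_one hn⟩

theorem traceZeroProj_mul_mul_mem (hn : (n : F) ≠ 0) (f : Gl F n) :
    traceZeroProj F n * f * traceZeroProj F n ∈ glSub F n :=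
  mem_glSub.2 ⟨fun _ _ => trace_traceZeroProj hn _, by simp [traceZeroProj_one hn]⟩

theorem traceZeroProj_mul_scalarProj_mem (hn : (n : F) ≠ 0) (f : Gl F n) :
    traceZeroProj F n * f * scalarProj F n ∈ pSpace F n :=
  (mem_pSpace hn).2 ⟨fun x hx => by simp [scalarProj_apply, hx], trace_traceZeroProj hn _⟩

theorem scalarProj_mul_traceZeroProj_mem (hn : (n : F) ≠ 0) (f : Gl F n) :
    scalarProj F n * f * traceZeroProj F n ∈ qSpace F n :=
  (mem_qSpace hn).2 ⟨fun x => ⟨_, scalarProj_apply _⟩, by simp [traceZeroProj_one hn]⟩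

theorem scalarProj_mul_mul_mem (hn : (n : F) ≠ 0) (f : Gl F n) :
    scalarProj F n * f * scalarProj F n ∈ scalarBlock F n :=
  (mem_scalarBlock hn).2 ⟨fun x hx => by simp [scalarProj_apply, hx], _, scalarProj_apply _⟩

theorem block_decomposition (f : Gl F n) :
    f = traceZeroProj F n * f * traceZeroProj F n + traceZeroProj F n * f * scalarProj F n +
      scalarProj F n * f * traceZeroProj F n + scalarProj F n * f * scalarProj F n := by
  rw [traceZeroProj, sub_mul, one_mul, mul_sub, mul_one, mul_sub, mul_one]
  abel

theorem scalarProj_one (hn : (n : F) ≠ 0) : scalarProj F n 1 = 1 := by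
  simp [scalarProj_apply, Matrix.trace_one, hn]

theorem traceZeroProj_mul_scalarProj_eq_zero (hn : (n : F) ≠ 0) {f : Gl F n}
    (hf : f ∈ scalarStab F n) : traceZeroProj F n * f * scalarProj F n = 0 := by
  obtain ⟨c, hc⟩ := hf
  ext1 x
  simp [scalarProj_apply, hc, traceZeroProj_one hn]

theorem scalarProj_mul_traceZeroProj_eq_zero (hn : (n : F) ≠ 0) {f : Gl F n}
    (hf : f ∈ traceZeroStab F n) : scalarProj F n * f * traceZeroProj F n = 0 := by
  ext1 x
  simp [scalarProj_apply, hf _ (trace_traceZeroProj hn x)]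

theorem scalarProj_mul_mul_eq_zero {f : Gl F n}
    (hf : f ∈ oneToTraceZero F n) : scalarProj F n * f * scalarProj F n = 0 := by
  ext1 x
  simp [scalarProj_apply, mem_oneToTraceZero.1 hf]

/-! ### Sums of blocks as intersections of stabilizers -/

/-- Each of the three conditions kills one block. The sums below are described in the same way,
which makes closure under products and inclusions easy to check. -/
theorem glSub_eq (hn : (n : F) ≠ 0) :
    glSub F n = scalarStab F n ⊓ traceZeroStab F n ⊓ oneToTraceZero F n := by
  ext f
  simp only [mem_glSub, Submodule.mem_inf, mem_scalarStab, mem_traceZeroStab, mem_oneToTraceZero]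
  constructor
  · rintro ⟨h, h1⟩
    exact ⟨⟨⟨0, by simp [h1]⟩, h⟩, by simp [h1]⟩
  · rintro ⟨⟨⟨c, h1⟩, h⟩, h2⟩
    refine ⟨h, ?_⟩
    rw [h1, Matrix.trace_smul, trace_one_eq, smul_eq_mul, mul_eq_zero_iff_right hn] at h2
    rw [h1, h2, zero_smul]

theorem pSpace_le (hn : (n : F) ≠ 0) : pSpace F n ≤ traceZeroStab F n ⊓ oneToTraceZero F n := by
  intro f hf
  obtain ⟨h, h1⟩ := (mem_pSpace hn).1 hf
  exact ⟨fun x hx => by simp [h x hx], h1⟩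

theorem qSpace_le (hn : (n : F) ≠ 0) : qSpace F n ≤ scalarStab F n ⊓ oneToTraceZero F n := by
  intro f hf
  obtain ⟨-, h1⟩ := (mem_qSpace hn).1 hf
  exact ⟨⟨0, by simp [h1]⟩, by simp [mem_oneToTraceZero, h1]⟩

theorem scalarBlock_le (hn : (n : F) ≠ 0) :
    scalarBlock F n ≤ scalarStab F n ⊓ traceZeroStab F n := by
  intro f hf
  obtain ⟨h, h1⟩ := (mem_scalarBlock hn).1 hf
  exact ⟨h1, fun x hx => by simp [h x hx]⟩

theorem glSub_sup_pSpace (hn : (n : F) ≠ 0) :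
    glSub F n ⊔ pSpace F n = traceZeroStab F n ⊓ oneToTraceZero F n := by
  refine le_antisymm (sup_le ?_ (pSpace_le hn)) ?_
  · rw [glSub_eq hn, inf_assoc]
    exact inf_le_right
  · rintro f ⟨hq, he⟩
    rw [block_decomposition f, scalarProj_mul_traceZeroProj_eq_zero hn hq,
      scalarProj_mul_mul_eq_zero he, add_zero, add_zero]
    exact Submodule.add_mem_sup (traceZeroProj_mul_mul_mem hn f)
      (traceZeroProj_mul_scalarProj_mem hn f)

theorem glSub_sup_qSpace (hn : (n : F) ≠ 0) :
    glSub F n ⊔ qSpace F n = scalarStab F n ⊓ oneToTraceZero F n := by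
  refine le_antisymm (sup_le ?_ (qSpace_le hn)) ?_
  · rw [glSub_eq hn]
    exact inf_le_inf_right _ inf_le_left
  · rintro f ⟨hp, he⟩
    rw [block_decomposition f, traceZeroProj_mul_scalarProj_eq_zero hn hp,
      scalarProj_mul_mul_eq_zero he, add_zero, add_zero]
    exact Submodule.add_mem_sup (traceZeroProj_mul_mul_mem hn f)
      (scalarProj_mul_traceZeroProj_mem hn f)

theorem glSub_sup_scalarBlock (hn : (n : F) ≠ 0) :
    glSub F n ⊔ scalarBlock F n = scalarStab F n ⊓ traceZeroStab F n := by
  refine le_antisymm (sup_le ?_ (scalarBlock_le hn)) ?_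
  · rw [glSub_eq hn]
    exact inf_le_left
  · rintro f ⟨hp, hq⟩
    rw [block_decomposition f, traceZeroProj_mul_scalarProj_eq_zero hn hp,
      scalarProj_mul_traceZeroProj_eq_zero hn hq, add_zero, add_zero]
    exact Submodule.add_mem_sup (traceZeroProj_mul_mul_mem hn f)
      (scalarProj_mul_mul_mem hn f)

theorem glSub_sup_pSpace_sup_scalarBlock (hn : (n : F) ≠ 0) :
    glSub F n ⊔ pSpace F n ⊔ scalarBlock F n = traceZeroStab F n := by
  refine le_antisymm (sup_le ?_ ((scalarBlock_le hn).trans inf_le_right)) ?_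
  · rw [glSub_sup_pSpace hn]
    exact inf_le_left
  · intro f hq
    rw [block_decomposition f, scalarProj_mul_traceZeroProj_eq_zero hn hq, add_zero]
    exact Submodule.add_mem_sup (Submodule.add_mem_sup (traceZeroProj_mul_mul_mem hn f)
      (traceZeroProj_mul_scalarProj_mem hn f)) (scalarProj_mul_mul_mem hn f)

theorem glSub_sup_qSpace_sup_scalarBlock (hn : (n : F) ≠ 0) :
    glSub F n ⊔ qSpace F n ⊔ scalarBlock F n = scalarStab F n := by
  refine le_antisymm (sup_le ?_ ((scalarBlock_le hn).trans inf_le_left)) ?_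
  · rw [glSub_sup_qSpace hn]
    exact inf_le_left
  · intro f hp
    rw [block_decomposition f, traceZeroProj_mul_scalarProj_eq_zero hn hp, add_zero]
    exact Submodule.add_mem_sup (Submodule.add_mem_sup (traceZeroProj_mul_mul_mem hn f)
      (scalarProj_mul_traceZeroProj_mem hn f)) (scalarProj_mul_mul_mem hn f)

/-! ### Independence of the choice of torus element -/

/-- Adding the line of any element of the torus to `gl(n² - 1)` gives the same space. -/
theorem glSub_sup_line (hn : (n : F) ≠ 0) {t : Gl F n} (ht : t ∈ torus F n) :
    glSub F n ⊔ line t = glSub F n ⊔ scalarBlock F n := by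
  obtain ⟨α, β, -, hβ, h0, h1⟩ := ht
  have key : t = α • traceZeroProj F n + β • scalarProj F n := by
    ext1 x
    have hx : x = traceZeroProj F n x + scalarProj F n x := by simp [traceZeroProj]
    conv_lhs => rw [hx]
    rw [map_add, h0 _ (mem_traceZero.2 (trace_traceZeroProj hn x)),
      h1 _ (mem_scalars.2 ⟨_, (scalarProj_apply x).symm⟩)]
    rfl
  have hP := traceZeroProj_mem_glSub (F := F) hn
  refine le_antisymm (sup_le le_sup_left ?_) (sup_le le_sup_left ?_)
  · refine (Submodule.span_singleton_le_iff_mem _ _).2 ?_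
    rw [key]
    exact Submodule.add_mem_sup (Submodule.smul_mem _ _ hP)
      (Submodule.smul_mem _ _ (Submodule.mem_span_singleton_self _))
  · refine (Submodule.span_singleton_le_iff_mem _ _).2 ?_
    have : scalarProj F n = (-(β⁻¹ * α)) • traceZeroProj F n + β⁻¹ • t := by
      rw [key, smul_add, smul_smul, smul_smul, inv_mul_cancel₀ hβ]
      module
    rw [this]
    exact Submodule.add_mem_sup (Submodule.smul_mem _ _ hP)
      (Submodule.smul_mem _ _ (Submodule.mem_span_singleton_self _))

theorem one_mem_torus : (1 : Gl F n) ∈ torus F n :=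
  ⟨1, 1, one_ne_zero, one_ne_zero, fun x _ => by simp, fun x _ => by simp⟩

theorem exists_torus_glSub_sup_line_iff (hn : (n : F) ≠ 0) {A : Submodule F (Gl F n)} :
    (∃ t ∈ torus F n, A = glSub F n ⊔ line t) ↔ A = glSub F n ⊔ scalarBlock F n :=
  ⟨fun ⟨_, ht, h⟩ => h.trans (glSub_sup_line hn ht),
    fun h => ⟨1, one_mem_torus, h.trans (glSub_sup_line hn one_mem_torus).symm⟩⟩

theorem exists_torus_glSub_sup_sup_line_iff (hn : (n : F) ≠ 0) {A B : Submodule F (Gl F n)} :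
    (∃ t ∈ torus F n, A = glSub F n ⊔ B ⊔ line t) ↔ A = glSub F n ⊔ B ⊔ scalarBlock F n := by
  have key : ∀ t ∈ torus F n, glSub F n ⊔ B ⊔ line t = glSub F n ⊔ B ⊔ scalarBlock F n := by
    intro t ht
    rw [sup_right_comm, glSub_sup_line hn ht, sup_right_comm]
  exact ⟨fun ⟨t, ht, h⟩ => h.trans (key t ht),
    fun h => ⟨1, one_mem_torus, h.trans (key 1 one_mem_torus).symm⟩⟩

/-! ### Inner derivations generate `gl(n² - 1)` -/

/-- The bilinear map taking `a` and `b` to the operator `x ↦ tr(x b) a`. -/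
def rankOne : Mat F n →ₗ[F] Mat F n →ₗ[F] Gl F n :=
  LinearMap.mk₂ F
    (fun a b => (Matrix.traceLinearMap (Fin n) F F ∘ₗ LinearMap.mulRight F b).smulRight a)
    (fun a b c => by ext1 x; simp [smul_add])
    (fun r a b => by ext1 x; simp only [LinearMap.smulRight_apply, LinearMap.smul_apply,
      smul_comm r])
    (fun a b c => by ext1 x; simp [mul_add, add_smul])
    (fun r a b => by ext1 x; simp [smul_smul])

theorem rankOne_apply (a b x : Mat F n) : rankOne a b x = (x * b).trace • a := by
  simp [rankOne]

/-- A nonzero Lie ideal of `M_n` containing an off-diagonal matrix unit contains `M_n⁰`. -/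
theorem traceZero_le_of_single_mem (hn : 3 ≤ n) {L : Submodule F (Mat F n)}
    (hL : ∀ c : Mat F n, ∀ x ∈ L, c * x - x * c ∈ L) {i j : Fin n} (hij : i ≠ j)
    (h : Matrix.single i j (1 : F) ∈ L) : traceZero F n ≤ L := by
  -- `[e_ki, e_ij] = e_kj` for `k ≠ j`; `col` uses `[e_jl, e_ij] = -e_il` for `l ≠ i`.
  have row : ∀ i j k : Fin n, i ≠ j → k ≠ j → Matrix.single i j (1 : F) ∈ L →
      Matrix.single k j (1 : F) ∈ L := by
    intro i j k hij hkj h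
    have := hL (Matrix.single k i 1) _ h
    rwa [Matrix.single_mul_single_same, Matrix.single_mul_single_of_ne _ _ _ _ hkj.symm,
      sub_zero, mul_one] at this
  have col : ∀ i j l : Fin n, i ≠ j → l ≠ i → Matrix.single i j (1 : F) ∈ L →
      Matrix.single i l (1 : F) ∈ L := by
    intro i j l hij hli h
    have := hL (Matrix.single j l 1) _ h
    rw [Matrix.single_mul_single_same, Matrix.single_mul_single_of_ne _ _ _ _ hli,
      zero_sub, mul_one] at this
    exact (Submodule.neg_mem_iff _).1 this
  have off : ∀ k l : Fin n, k ≠ l → Matrix.single k l (1 : F) ∈ L := by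
    intro k l hkl
    -- A spare index, available because `n ≥ 3`, lets the chain `e_ij, e_im, e_km, e_kl` stay off
    -- the diagonal.
    obtain ⟨m, hm⟩ : ∃ m, m ∉ ({i, k} : Finset (Fin n)) := by
      by_contra! hall
      have h1 := Finset.card_le_card (fun x _ => hall x : Finset.univ ⊆ ({i, k} : Finset (Fin n)))
      have h2 := Finset.card_le_two (a := i) (b := k)
      simp only [Finset.card_univ, Fintype.card_fin] at h1
      omega
    simp only [Finset.mem_insert, Finset.mem_singleton, not_or] at hm
    exact col k m l (Ne.symm hm.2) hkl.symm
      (row i m k (Ne.symm hm.1) (Ne.symm hm.2) (col i j m hij hm.1 h))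
  have diag : ∀ k l : Fin n, Matrix.single k k (1 : F) - Matrix.single l l 1 ∈ L := by
    intro k l
    rcases eq_or_ne k l with rfl | hkl
    · simp
    · have := hL (Matrix.single k l 1) _ (off l k hkl.symm)
      rwa [Matrix.single_mul_single_same, Matrix.single_mul_single_same, mul_one] at this
  intro x hx
  have hx := mem_traceZero.1 hx
  -- The corrections add up to `tr(x) e_ii = 0`; they turn each diagonal unit into a difference
  -- `e_kk - e_ii`.
  have hsum : x = ∑ k, ∑ l, x k l •
      (Matrix.single k l (1 : F) - if k = l then Matrix.single i i 1 else 0) := by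
    simp only [smul_sub, Finset.sum_sub_distrib]
    have h2 : ∑ k, ∑ l, x k l • (if k = l then Matrix.single i i (1 : F) else 0) = 0 := by
      simp only [smul_ite, smul_zero, Finset.sum_ite_eq, Finset.mem_univ, if_true]
      rw [← Finset.sum_smul]
      change x.trace • _ = _
      rw [hx, zero_smul]
    rw [h2, sub_zero]
    conv_lhs => rw [Matrix.matrix_eq_sum_single x]
    simp [Matrix.smul_single]
  rw [hsum]
  refine Submodule.sum_mem _ fun k _ => Submodule.sum_mem _ fun l _ => Submodule.smul_mem _ _ ?_
  split_ifs with hkl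
  · subst hkl
    exact diag k i
  · rw [sub_zero]
    exact off k l hkl

theorem exists_ne_of_two_le (hn2 : 2 ≤ n) : ∃ i j : Fin n, i ≠ j :=
  ⟨⟨0, by omega⟩, ⟨1, by omega⟩, by simp⟩

theorem rankOne_single_mem [CharZero F] {A : Submodule F (Gl F n)}
    (hmul : ∀ f ∈ A, ∀ g ∈ A, f * g ∈ A) (hA : innerDer F n ≤ A) {i j : Fin n} (hij : i ≠ j) :
    rankOne (Matrix.single i j (1 : F)) (Matrix.single i j 1) ∈ A := by
  have had := hA (LinearMap.mem_range_self _ (Matrix.single i j (1 : F)))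
  have h := A.smul_mem (-(2 : F)⁻¹) (hmul _ had _ had)
  convert h using 1
  ext1 x
  have hs : Matrix.single i j (1 : F) * Matrix.single i j 1 = 0 :=
    Matrix.single_mul_single_of_ne _ _ _ _ hij.symm _
  have hx : Matrix.single i j (1 : F) * x * Matrix.single i j 1 =
      (x * Matrix.single i j 1).trace • Matrix.single i j (1 : F) := by
    rw [Matrix.trace_mul_single]
    simp [Matrix.smul_single]
  simp only [rankOne_apply, LinearMap.smul_apply, Module.End.mul_apply, LinearMap.sub_apply,
    LinearMap.mul_apply', LinearMap.flip_apply, mul_sub, sub_mul]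
  rw [← hx, ← mul_assoc, hs, mul_assoc x, hs, ← mul_assoc, zero_mul, mul_zero]
  module

/-- Writing `R(a, b)` for `rankOne a b`, we have `ad c ∘ R(a, b) = R([c, a], b)` and `R(a, b) ∘ ad c
= -R(a, [c, b])`. So for one argument fixed, the admissible values of the other form a Lie ideal of
`M_n`. -/
theorem rankOne_mem [CharZero F] (hn : 3 ≤ n) {A : Submodule F (Gl F n)}
    (hmul : ∀ f ∈ A, ∀ g ∈ A, f * g ∈ A) (hA : innerDer F n ≤ A) {a b : Mat F n}
    (ha : a ∈ traceZero F n) (hb : b ∈ traceZero F n) : rankOne a b ∈ A := by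
  have had : ∀ c : Mat F n, (LinearMap.mul F (Mat F n) - (LinearMap.mul F (Mat F n)).flip) c ∈ A :=
    fun c => hA ⟨c, rfl⟩
  obtain ⟨i, j, hij⟩ := exists_ne_of_two_le (n := n) (by omega)
  have left : traceZero F n ≤ A.comap (rankOne.flip (Matrix.single i j 1)) := by
    refine traceZero_le_of_single_mem hn (fun c a ha => ?_) hij ?_
    · rw [Submodule.mem_comap, LinearMap.flip_apply] at ha ⊢
      convert hmul _ (had c) _ ha using 1
      ext1 x
      simp [rankOne_apply, smul_sub]
    · rw [Submodule.mem_comap, LinearMap.flip_apply]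
      exact rankOne_single_mem hmul hA hij
  have right : traceZero F n ≤ A.comap (rankOne a) := by
    refine traceZero_le_of_single_mem hn (fun c b hb => ?_) hij ?_
    · rw [Submodule.mem_comap] at hb ⊢
      rw [← neg_sub]
      convert A.neg_mem (hmul _ hb _ (had c)) using 1
      ext1 x
      simp only [rankOne_apply, LinearMap.neg_apply, Module.End.mul_apply, LinearMap.sub_apply,
        LinearMap.mul_apply', LinearMap.flip_apply, ← neg_smul]
      congr 1
      rw [mul_neg, Matrix.trace_neg, mul_sub, sub_mul, Matrix.trace_sub, Matrix.trace_sub,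
        ← mul_assoc x b c, Matrix.trace_mul_comm (x * b) c, mul_assoc c, mul_assoc x c]
    · have h := left ha
      rwa [Submodule.mem_comap, LinearMap.flip_apply] at h
  exact right hb

/-- A nonunital subalgebra containing all inner derivations contains `gl(n² - 1)`. -/
theorem glSub_le_of_innerDer_le [CharZero F] (hn : 3 ≤ n) {A : Submodule F (Gl F n)}
    (hmul : ∀ f ∈ A, ∀ g ∈ A, f * g ∈ A) (hA : innerDer F n ≤ A) : glSub F n ≤ A := by
  have hn0 : (n : F) ≠ 0 := Nat.cast_ne_zero.2 (by omega)
  intro f hf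
  obtain ⟨hf0, hf1⟩ := mem_glSub.1 hf
  have hfP : ∀ x, f (traceZeroProj F n x) = f x := fun x => by
    rw [traceZeroProj_apply, map_sub, map_smul, hf1, smul_zero, sub_zero]
  -- Expansion in the dual bases `e_kl`, `e_lk`: `P` is self-adjoint for the trace form, so `tr(x
  -- P(e_lk))` is the `(k, l)` entry of `P x`, and `f = f P`.
  have key : f = ∑ k, ∑ l, rankOne (f (Matrix.single k l (1 : F)))
      (traceZeroProj F n (Matrix.single l k (1 : F))) := by
    ext1 x
    have e : ∀ k l, rankOne (f (Matrix.single k l (1 : F)))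
        (traceZeroProj F n (Matrix.single l k (1 : F))) x =
        f (traceZeroProj F n x k l • Matrix.single k l (1 : F)) := by
      intro k l
      rw [rankOne_apply, map_smul, traceZeroProj_apply, traceZeroProj_apply, mul_sub,
        Matrix.trace_sub, Matrix.trace_mul_single, Matrix.mul_smul, mul_one, Matrix.trace_smul,
        Matrix.sub_apply, Matrix.smul_apply]
      congr 1
      rcases eq_or_ne l k with rfl | hkl
      · simp [Matrix.trace_single_eq_same]
      · simp [Matrix.trace_single_eq_of_ne _ _ _ hkl, Matrix.one_apply_ne hkl.symm]
    rw [← hfP x]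
    simp only [LinearMap.sum_apply, e]
    conv_lhs => rw [Matrix.matrix_eq_sum_single (traceZeroProj F n x)]
    simp only [map_sum, Matrix.smul_single, smul_eq_mul, mul_one]
  rw [key]
  refine Submodule.sum_mem _ fun k _ => Submodule.sum_mem _ fun l _ => rankOne_mem hn hmul hA ?_ ?_
  · rw [← hfP]
    exact mem_traceZero.2 (hf0 _ (trace_traceZeroProj hn0 _))
  · exact mem_traceZero.2 (trace_traceZeroProj hn0 _)

/-! ### Subalgebras containing `gl(n² - 1)` -/

section Classification

variable {A : Submodule F (Gl F n)}

/-- Left multiplication by `gl(n² - 1)` can carry a nonzero `a ∈ M_n⁰` to any `b ∈ M_n⁰`. -/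
theorem pSpace_le_of_mem (hn : (n : F) ≠ 0) (hmul : ∀ f ∈ A, ∀ g ∈ A, f * g ∈ A)
    (hE : glSub F n ≤ A) {f : Gl F n} (hfA : f ∈ A) (hf : f ∈ pSpace F n) (hf0 : f ≠ 0) :
    pSpace F n ≤ A := by
  obtain ⟨a, ha, rfl⟩ := hf
  have ha0 : a ≠ 0 := by
    rintro rfl
    exact hf0 (map_zero _)
  obtain ⟨φ, hφ⟩ := Module.Projective.exists_dual_ne_zero F ha0
  rintro _ ⟨b, hb, rfl⟩
  -- Precomposing `φ` with `P` makes the operator kill `1` without changing its value at `a`.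
  have hg : ((φ a)⁻¹ • φ ∘ₗ traceZeroProj F n).smulRight b ∈ glSub F n :=
    mem_glSub.2 ⟨fun x _ => by simp [mem_traceZero.1 hb], by simp [traceZeroProj_one hn]⟩
  convert hmul _ (hE hg) _ hfA using 1
  ext1 x
  simp [pMap_apply, traceZeroProj_of_trace_eq_zero (mem_traceZero.1 ha), hφ]

theorem qSpace_le_of_mem (hn : (n : F) ≠ 0) (hmul : ∀ f ∈ A, ∀ g ∈ A, f * g ∈ A)
    (hE : glSub F n ≤ A) {f : Gl F n} (hfA : f ∈ A) (hf : f ∈ qSpace F n) (hf0 : f ≠ 0) :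
    qSpace F n ≤ A := by
  obtain ⟨a, ha, rfl⟩ := hf
  obtain ⟨y, hy⟩ : ∃ y : Mat F n, (y * a).trace ≠ 0 := by
    by_contra! h
    exact hf0 (by ext1 x; simp [qMap_apply, h])
  rintro _ ⟨b, hb, rfl⟩
  -- Right multiplication replaces `tr(x a)` by `tr(x b)`. Passing from `y` to `P y` keeps the range
  -- in `M_n⁰`, and `tr(P(y) a) = tr(y a)` because `tr a = 0`.
  have hg : rankOne (((y * a).trace)⁻¹ • traceZeroProj F n y) b ∈ glSub F n :=
    mem_glSub.2 ⟨fun x _ => by simp [rankOne_apply, trace_traceZeroProj hn],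
      by simp [rankOne_apply, mem_traceZero.1 hb]⟩
  convert hmul _ hfA _ (hE hg) using 1
  ext1 x
  simp [qMap_apply, rankOne_apply, traceZeroProj_apply, sub_mul, mem_traceZero.1 ha]
  rw [smul_smul]
  congr 1
  field_simp

theorem scalarBlock_le_of_mem {f : Gl F n} (hfA : f ∈ A) (hf : f ∈ scalarBlock F n)
    (hf0 : f ≠ 0) : scalarBlock F n ≤ A := by
  obtain ⟨c, rfl⟩ := Submodule.mem_span_singleton.1 hf
  have hc : c ≠ 0 := by
    rintro rfl
    exact hf0 (zero_smul _ _)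
  refine (Submodule.span_singleton_le_iff_mem _ _).2 ?_
  exact (Submodule.smul_mem_iff _ hc).1 hfA

theorem pSpace_le_or_le_scalarStab (hn : (n : F) ≠ 0) (hmul : ∀ f ∈ A, ∀ g ∈ A, f * g ∈ A)
    (hE : glSub F n ≤ A) : pSpace F n ≤ A ∨ A ≤ scalarStab F n := by
  by_cases h : ∀ f ∈ A, traceZeroProj F n * f * scalarProj F n = 0
  · refine Or.inr fun f hf => ?_
    have h1 := LinearMap.congr_fun (h f hf) 1
    rw [Module.End.mul_apply, Module.End.mul_apply, scalarProj_one hn, traceZeroProj_apply,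
      LinearMap.zero_apply, sub_eq_zero] at h1
    exact ⟨_, h1⟩
  · push Not at h
    obtain ⟨f, hf, hne⟩ := h
    refine Or.inl (pSpace_le_of_mem hn hmul hE ?_ (traceZeroProj_mul_scalarProj_mem hn f) hne)
    have hP := hE (traceZeroProj_mem_glSub hn)
    -- `S` need not lie in `A`, so the block is rewritten with `S = 1 - P` using only `f` and `P`.
    -- The same device serves the other two blocks.
    have : traceZeroProj F n * f * scalarProj F n =
        traceZeroProj F n * f - traceZeroProj F n * f * traceZeroProj F n := by
      rw [traceZeroProj, mul_sub, mul_one, sub_sub_cancel]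
    rw [this]
    exact A.sub_mem (hmul _ hP _ hf) (hmul _ (hmul _ hP _ hf) _ hP)

theorem qSpace_le_or_le_traceZeroStab (hn : (n : F) ≠ 0)
    (hmul : ∀ f ∈ A, ∀ g ∈ A, f * g ∈ A) (hE : glSub F n ≤ A) :
    qSpace F n ≤ A ∨ A ≤ traceZeroStab F n := by
  by_cases h : ∀ f ∈ A, scalarProj F n * f * traceZeroProj F n = 0
  · refine Or.inr fun f hf x hx => ?_
    have h1 := congrArg Matrix.trace (LinearMap.congr_fun (h f hf) x)
    rw [Module.End.mul_apply, Module.End.mul_apply, traceZeroProj_of_trace_eq_zero hx,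
      scalarProj_apply, LinearMap.zero_apply, Matrix.trace_smul, trace_one_eq, Matrix.trace_zero,
      smul_eq_mul] at h1
    simpa [hn] using h1
  · push Not at h
    obtain ⟨f, hf, hne⟩ := h
    refine Or.inl (qSpace_le_of_mem hn hmul hE ?_ (scalarProj_mul_traceZeroProj_mem hn f) hne)
    have hP := hE (traceZeroProj_mem_glSub hn)
    have : scalarProj F n * f * traceZeroProj F n =
        f * traceZeroProj F n - traceZeroProj F n * f * traceZeroProj F n := by
      rw [← sub_mul]
      congr 1
      rw [traceZeroProj, sub_mul, one_mul, sub_sub_cancel]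
    rw [this]
    exact A.sub_mem (hmul _ hf _ hP) (hmul _ (hmul _ hP _ hf) _ hP)

theorem scalarBlock_le_or_le_oneToTraceZero (hn : (n : F) ≠ 0)
    (hmul : ∀ f ∈ A, ∀ g ∈ A, f * g ∈ A) (hE : glSub F n ≤ A) :
    scalarBlock F n ≤ A ∨ A ≤ oneToTraceZero F n := by
  by_cases h : ∀ f ∈ A, scalarProj F n * f * scalarProj F n = 0
  · refine Or.inr fun f hf => ?_
    have h1 := congrArg Matrix.trace (LinearMap.congr_fun (h f hf) 1)
    rw [Module.End.mul_apply, Module.End.mul_apply, scalarProj_one hn,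
      scalarProj_apply, LinearMap.zero_apply, Matrix.trace_smul, trace_one_eq, Matrix.trace_zero,
      smul_eq_mul] at h1
    simpa [hn, mem_oneToTraceZero] using h1
  · push Not at h
    obtain ⟨f, hf, hne⟩ := h
    refine Or.inl (scalarBlock_le_of_mem ?_ (scalarProj_mul_mul_mem hn f) hne)
    have hP := hE (traceZeroProj_mem_glSub hn)
    have : scalarProj F n * f * scalarProj F n = f - traceZeroProj F n * f -
        (f * traceZeroProj F n - traceZeroProj F n * f * traceZeroProj F n) := by
      simp only [traceZeroProj, sub_mul, one_mul, mul_sub, mul_one]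
      abel
    rw [this]
    exact A.sub_mem (A.sub_mem hf (hmul _ hP _ hf))
      (A.sub_mem (hmul _ hf _ hP) (hmul _ (hmul _ hP _ hf) _ hP))

/-- Since `tr(e_ij e_ji) = 1`, the operator of `q` given by `e_ji` after that of `p` given by `e_ij`
is `n S`. Thus all four blocks lie in `A`. -/
theorem eq_top_of_pSpace_le_of_qSpace_le (hn : (n : F) ≠ 0) (hn2 : 2 ≤ n)
    (hmul : ∀ f ∈ A, ∀ g ∈ A, f * g ∈ A) (hE : glSub F n ≤ A) (hp : pSpace F n ≤ A)
    (hq : qSpace F n ≤ A) : A = ⊤ := by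
  obtain ⟨i, j, hij⟩ := exists_ne_of_two_le hn2
  have hS : scalarProj F n ∈ A := by
    have h := A.smul_mem (n : F)⁻¹ (hmul _
      (hq ⟨Matrix.single j i 1, mem_traceZero.2 (Matrix.trace_single_eq_of_ne _ _ _ hij.symm), rfl⟩)
      _ (hp ⟨Matrix.single i j 1, mem_traceZero.2 (Matrix.trace_single_eq_of_ne _ _ _ hij), rfl⟩))
    convert h using 1
    ext1 x
    rw [LinearMap.smul_apply, Module.End.mul_apply, pMap_apply, map_smul, qMap_apply,
      Matrix.single_mul_single_same, Matrix.trace_single_eq_same, scalarProj_apply, mul_one,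
      one_smul, smul_smul]
  refine eq_top_iff.2 fun f _ => ?_
  rw [block_decomposition f]
  exact A.add_mem (A.add_mem (A.add_mem (hE (traceZeroProj_mul_mul_mem hn f))
    (hp (traceZeroProj_mul_scalarProj_mem hn f))) (hq (scalarProj_mul_traceZeroProj_mem hn f)))
    ((Submodule.span_singleton_le_iff_mem _ _).2 hS (scalarProj_mul_mul_mem hn f))

/-- Three dichotomies give eight cases. The two containing both `p` and `q` force `A = ⊤`; in the
others the upper bound from stabilizers meets the lower bound from blocks. -/
theorem eq_of_glSub_le (hn : (n : F) ≠ 0) (hn2 : 2 ≤ n) (hmul : ∀ f ∈ A, ∀ g ∈ A, f * g ∈ A)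
    (hE : glSub F n ≤ A) (hA : A ≠ ⊤) :
    A = glSub F n ∨ A = glSub F n ⊔ pSpace F n ∨ A = glSub F n ⊔ qSpace F n ∨
      A = glSub F n ⊔ scalarBlock F n ∨ A = glSub F n ⊔ pSpace F n ⊔ scalarBlock F n ∨
      A = glSub F n ⊔ qSpace F n ⊔ scalarBlock F n := by
  rcases pSpace_le_or_le_scalarStab hn hmul hE with hp | hp <;>
  rcases qSpace_le_or_le_traceZeroStab hn hmul hE with hq | hq <;>
  rcases scalarBlock_le_or_le_oneToTraceZero hn hmul hE with hr | hr
  · exact absurd (eq_top_of_pSpace_le_of_qSpace_le hn hn2 hmul hE hp hq) hA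
  · exact absurd (eq_top_of_pSpace_le_of_qSpace_le hn hn2 hmul hE hp hq) hA
  · iterate 4 right
    left
    exact le_antisymm (hq.trans_eq (glSub_sup_pSpace_sup_scalarBlock hn).symm)
      (sup_le (sup_le hE hp) hr)
  · right; left
    exact le_antisymm ((le_inf hq hr).trans_eq (glSub_sup_pSpace hn).symm) (sup_le hE hp)
  · iterate 5 right
    exact le_antisymm (hp.trans_eq (glSub_sup_qSpace_sup_scalarBlock hn).symm)
      (sup_le (sup_le hE hq) hr)
  · iterate 2 right
    left
    exact le_antisymm ((le_inf hp hr).trans_eq (glSub_sup_qSpace hn).symm) (sup_le hE hq)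
  · iterate 3 right
    left
    exact le_antisymm ((le_inf hp hq).trans_eq (glSub_sup_scalarBlock hn).symm) (sup_le hE hr)
  · left
    exact le_antisymm ((le_inf (le_inf hp hq) hr).trans_eq (glSub_eq hn).symm) hE

end Classification

/-! ### The six sums are proper subalgebras -/

theorem isProperSubalgebraOverInnerDer_iff {A : Submodule F (Gl F n)} :
    IsProperSubalgebraOverInnerDer A ↔
      (∀ f ∈ A, ∀ g ∈ A, f * g ∈ A) ∧ A ≠ ⊤ ∧ innerDer F n ≤ A := by
  refine and_congr_left fun _ => ⟨?_, fun h =>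
    ⟨{ A with mul_mem' := fun {f g} hf hg => h f hf g hg }, rfl⟩⟩
  rintro ⟨B, rfl⟩ f hf g hg
  exact B.mul_mem hf hg

theorem innerDer_le_glSub : innerDer F n ≤ glSub F n := by
  rintro _ ⟨c, rfl⟩
  refine mem_glSub.2 ⟨fun x _ => ?_, ?_⟩
  · simp [Matrix.trace_mul_comm c x]
  · simp

theorem mul_mem_scalarStab {f g : Gl F n} (hf : f ∈ scalarStab F n) (hg : g ∈ scalarStab F n) :
    f * g ∈ scalarStab F n := by
  obtain ⟨c, hc⟩ := hf
  obtain ⟨d, hd⟩ := hg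
  exact ⟨d * c, by rw [Module.End.mul_apply, hd, map_smul, hc, smul_smul]⟩

theorem mul_mem_traceZeroStab {f g : Gl F n} (hf : f ∈ traceZeroStab F n)
    (hg : g ∈ traceZeroStab F n) : f * g ∈ traceZeroStab F n :=
  fun x hx => hf _ (hg x hx)

/-- Here `g 1` has trace zero and `f` preserves that. In the companion below, `g 1` is scalar and
`f` sends scalars to trace zero. -/
theorem mul_mem_traceZeroStab_inf_oneToTraceZero {f g : Gl F n}
    (hf : f ∈ traceZeroStab F n ⊓ oneToTraceZero F n)
    (hg : g ∈ traceZeroStab F n ⊓ oneToTraceZero F n) :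
    f * g ∈ traceZeroStab F n ⊓ oneToTraceZero F n :=
  ⟨mul_mem_traceZeroStab hf.1 hg.1, hf.1 _ hg.2⟩

theorem mul_mem_scalarStab_inf_oneToTraceZero {f g : Gl F n}
    (hf : f ∈ scalarStab F n ⊓ oneToTraceZero F n)
    (hg : g ∈ scalarStab F n ⊓ oneToTraceZero F n) :
    f * g ∈ scalarStab F n ⊓ oneToTraceZero F n := by
  refine ⟨mul_mem_scalarStab hf.1 hg.1, ?_⟩
  obtain ⟨d, hd⟩ := hg.1
  rw [SetLike.mem_coe, mem_oneToTraceZero, Module.End.mul_apply, hd, map_smul, Matrix.trace_smul,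
    mem_oneToTraceZero.1 hf.2, smul_zero]

/-- A proper subspace that is closed under products and contains `gl(n² - 1)` is a proper
subalgebra containing the inner derivations. -/
theorem isProperSubalgebraOverInnerDer_of_le {A : Submodule F (Gl F n)}
    (hmul : ∀ f g, f ∈ A → g ∈ A → f * g ∈ A) {f : Gl F n} (hf : f ∉ A) (hE : glSub F n ≤ A) :
    IsProperSubalgebraOverInnerDer A :=
  isProperSubalgebraOverInnerDer_iff.2
    ⟨fun f hf g hg => hmul f g hf hg, fun h => hf (h ▸ Submodule.mem_top),
      innerDer_le_glSub.trans hE⟩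

theorem exists_notMem_scalarStab (hn : (n : F) ≠ 0) (hn2 : 2 ≤ n) :
    ∃ f ∈ traceZeroStab F n ⊓ oneToTraceZero F n, f ∉ scalarStab F n := by
  obtain ⟨i, j, hij⟩ := exists_ne_of_two_le hn2
  have ht : (Matrix.single i j (1 : F)).trace = 0 := Matrix.trace_single_eq_of_ne _ _ _ hij
  refine ⟨pMap F n (Matrix.single i j 1), pSpace_le hn ⟨_, mem_traceZero.2 ht, rfl⟩, ?_⟩
  rintro ⟨c, hc⟩
  have := congrFun (congrFun hc i) j
  simp [pMap_apply, hn, Matrix.one_apply_ne hij] at this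

theorem exists_notMem_traceZeroStab (hn : (n : F) ≠ 0) (hn2 : 2 ≤ n) :
    ∃ f ∈ scalarStab F n ⊓ oneToTraceZero F n, f ∉ traceZeroStab F n := by
  obtain ⟨i, j, hij⟩ := exists_ne_of_two_le hn2
  refine ⟨qMap F n (Matrix.single j i 1), qSpace_le hn
    ⟨_, mem_traceZero.2 (Matrix.trace_single_eq_of_ne _ _ _ hij.symm), rfl⟩, fun h => ?_⟩
  have := h (Matrix.single i j 1) (Matrix.trace_single_eq_of_ne _ _ _ hij)
  simp [qMap_apply, hn] at this

theorem scalarProj_notMem_oneToTraceZero (hn : (n : F) ≠ 0) :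
    scalarProj F n ∉ oneToTraceZero F n := by
  rwa [mem_oneToTraceZero, scalarProj_one hn, trace_one_eq]

theorem isProperSubalgebraOverInnerDer_iff_eq [CharZero F] (hn3 : 3 ≤ n)
    {A : Submodule F (Gl F n)} :
    IsProperSubalgebraOverInnerDer A ↔
      A = glSub F n ∨ A = glSub F n ⊔ pSpace F n ∨ A = glSub F n ⊔ qSpace F n ∨
        A = glSub F n ⊔ scalarBlock F n ∨ A = glSub F n ⊔ pSpace F n ⊔ scalarBlock F n ∨
        A = glSub F n ⊔ qSpace F n ⊔ scalarBlock F n := by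
  have hn : (n : F) ≠ 0 := Nat.cast_ne_zero.2 (by omega)
  have hn2 : 2 ≤ n := by omega
  constructor
  · intro h
    obtain ⟨hmul, htop, hg⟩ := isProperSubalgebraOverInnerDer_iff.1 h
    exact eq_of_glSub_le hn hn2 hmul (glSub_le_of_innerDer_le hn3 hmul hg) htop
  · obtain ⟨p, -, hp⟩ := exists_notMem_scalarStab hn hn2
    obtain ⟨q, -, hq⟩ := exists_notMem_traceZeroStab hn hn2
    rintro (rfl | rfl | rfl | rfl | rfl | rfl)
    · refine isProperSubalgebraOverInnerDer_of_le (f := p) ?_ ?_ le_rfl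
      · intro f g hf hg
        rw [glSub_eq hn] at *
        exact ⟨⟨mul_mem_scalarStab hf.1.1 hg.1.1, mul_mem_traceZeroStab hf.1.2 hg.1.2⟩,
          hf.1.2 _ hg.2⟩
      · rw [glSub_eq hn]
        exact fun h => hp h.1.1
    · refine isProperSubalgebraOverInnerDer_of_le (f := q) ?_ ?_ le_sup_left
      · rw [glSub_sup_pSpace hn]
        exact fun _ _ => mul_mem_traceZeroStab_inf_oneToTraceZero
      · rw [glSub_sup_pSpace hn]
        exact fun h => hq h.1
    · refine isProperSubalgebraOverInnerDer_of_le (f := p) ?_ ?_ le_sup_left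
      · rw [glSub_sup_qSpace hn]
        exact fun _ _ => mul_mem_scalarStab_inf_oneToTraceZero
      · rw [glSub_sup_qSpace hn]
        exact fun h => hp h.1
    · refine isProperSubalgebraOverInnerDer_of_le (f := p) ?_ ?_ le_sup_left
      · rw [glSub_sup_scalarBlock hn]
        exact fun _ _ hf hg => ⟨mul_mem_scalarStab hf.1 hg.1, mul_mem_traceZeroStab hf.2 hg.2⟩
      · rw [glSub_sup_scalarBlock hn]
        exact fun h => hp h.1
    · refine isProperSubalgebraOverInnerDer_of_le (f := q) ?_ ?_ (le_sup_left.trans le_sup_left)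
      · rw [glSub_sup_pSpace_sup_scalarBlock hn]
        exact fun _ _ => mul_mem_traceZeroStab
      · rwa [glSub_sup_pSpace_sup_scalarBlock hn]
    · refine isProperSubalgebraOverInnerDer_of_le (f := p) ?_ ?_ (le_sup_left.trans le_sup_left)
      · rw [glSub_sup_qSpace_sup_scalarBlock hn]
        exact fun _ _ => mul_mem_scalarStab
      · rwa [glSub_sup_qSpace_sup_scalarBlock hn]

/-! ### Counting -/

theorem ncard_sums_of_blocks (hn : (n : F) ≠ 0) (hn2 : 2 ≤ n) :
    ({glSub F n, glSub F n ⊔ pSpace F n, glSub F n ⊔ qSpace F n, glSub F n ⊔ scalarBlock F n,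
      glSub F n ⊔ pSpace F n ⊔ scalarBlock F n, glSub F n ⊔ qSpace F n ⊔ scalarBlock F n} :
      Set (Submodule F (Gl F n))).ncard = 6 := by
  obtain ⟨p, ⟨hp1, hp2⟩, hp⟩ := exists_notMem_scalarStab hn hn2
  obtain ⟨q, ⟨hq1, hq2⟩, hq⟩ := exists_notMem_traceZeroStab hn hn2
  have hr := scalarProj_notMem_oneToTraceZero hn
  obtain ⟨hr1, hr2⟩ := scalarBlock_le hn (Submodule.mem_span_singleton_self (scalarProj F n))
  rw [SetLike.mem_coe] at hp1 hp2 hq1 hq2 hr1 hr2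
  rw [glSub_sup_pSpace_sup_scalarBlock hn, glSub_sup_qSpace_sup_scalarBlock hn,
    glSub_sup_pSpace hn, glSub_sup_qSpace hn, glSub_sup_scalarBlock hn, glSub_eq hn]
  -- Each of `p`, `q` and `S` violates exactly one of the three stabilizer conditions, so membership
  -- of these three tells the six intersections apart.
  have key : ∀ {A B : Submodule F (Gl F n)},
      ¬((p ∈ A ↔ p ∈ B) ∧ (q ∈ A ↔ q ∈ B) ∧ (scalarProj F n ∈ A ↔ scalarProj F n ∈ B)) →
      A ≠ B := by
    rintro A B h rfl
    exact h ⟨Iff.rfl, Iff.rfl, Iff.rfl⟩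
  rw [Set.ncard_insert_of_notMem, Set.ncard_insert_of_notMem, Set.ncard_insert_of_notMem,
    Set.ncard_insert_of_notMem, Set.ncard_insert_of_notMem, Set.ncard_singleton] <;>
  · try simp only [Set.mem_insert_iff, Set.mem_singleton_iff, not_or]
    repeat' refine And.intro ?_ ?_
    all_goals
      apply key
      simp [Submodule.mem_inf, hp, hp1, hp2, hq, hq1, hq2, hr, hr1, hr2]

end InnerDerivations

theorem corollary2p6 {F : Type*} [Field F] [IsAlgClosed F] [CharZero F] (n : ℕ) (hn : 5 ≤ n) :
    (∀ A : Submodule F (InnerDerivations.Gl F n),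
      InnerDerivations.IsProperSubalgebraOverInnerDer A ↔
        A = InnerDerivations.glSub F n ∨
        A = InnerDerivations.glSub F n ⊔ InnerDerivations.pSpace F n ∨
        A = InnerDerivations.glSub F n ⊔ InnerDerivations.qSpace F n ∨
        (∃ t ∈ InnerDerivations.torus F n,
          A = InnerDerivations.glSub F n ⊔ InnerDerivations.line t) ∨
        (∃ t ∈ InnerDerivations.torus F n,
          A = InnerDerivations.glSub F n ⊔ InnerDerivations.pSpace F n ⊔
            InnerDerivations.line t) ∨
        (∃ t ∈ InnerDerivations.torus F n,
          A = InnerDerivations.glSub F n ⊔ InnerDerivations.qSpace F n ⊔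
            InnerDerivations.line t)) ∧
    {A : Submodule F (InnerDerivations.Gl F n) |
      InnerDerivations.IsProperSubalgebraOverInnerDer A}.ncard = 6 := by
  have hn0 : (n : F) ≠ 0 := Nat.cast_ne_zero.2 (by omega)
  constructor
  · intro A
    rw [InnerDerivations.isProperSubalgebraOverInnerDer_iff_eq (by omega),
      InnerDerivations.exists_torus_glSub_sup_line_iff hn0,
      InnerDerivations.exists_torus_glSub_sup_sup_line_iff hn0,
      InnerDerivations.exists_torus_glSub_sup_sup_line_iff hn0]
  · rw [← InnerDerivations.ncard_sums_of_blocks hn0 (by omega)]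
    congr 1
    ext A
    exact InnerDerivations.isProperSubalgebraOverInnerDer_iff_eq (by omega)
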